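/- Let $n\ge 0$ be an integer, $\mathcal N=\{1,\dots,n\}$, and let $\mathbb F_n$ be the real vector space of all families $h=(h(\alpha))_{\emptyset\ne\alpha\subseteq\mathcal N}$, with the convention $h(\emptyset)=0$. For $\alpha_1,\alpha_2,\alpha_3,\alpha_4\subseteq\mathcal N$ put $$\begin{aligned}J(h;\alpha_1,\alpha_2,\alpha_3,\alpha_4)={}&h(\alpha_1\cup\alpha_2)+h(\alpha_1\cup\alpha_3)+h(\alpha_1\cup\alpha_4)+h(\alpha_2\cup\alpha_3)+h(\alpha_2\cup\alpha_4)\\&-h(\alpha_1)-h(\alpha_2)-h(\alpha_3\cup\alpha_4)-h(\alpha_1\cup\alpha_2\cup\alpha_3)-h(\alpha_1\cup\alpha_2\cup\alpha_4).\end{aligned}$$ An Ingleton inequality is an inequality $J(h;\alpha_1,\alpha_2,\alpha_3,\alpha_4)\ge 0$ in $h\in\mathbb F_n$, with arbitrary $\alpha_i\subseteq\mathcal N$; two of them are regarded as the same inequality when their left-hand sides agree for all $h\in\mathbb F_n$. Let $\Gamma^{\mathrm{In}}$ be the set of all $h\in\mathbb F_n$ that satisfy all Ingleton inequalities. Let $\Delta=\Delta_0\cup\Delta_1\cup\Delta_2$,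 where - $\Delta_0$ consists of the inequalities $J(h;\delta_1\cup\beta,\delta_2\cup\beta,\delta_3\cup\beta,\delta_4\cup\beta)\ge 0$ with $\delta_1,\delta_2,\delta_3,\delta_4,\beta\subseteq\mathcal N$ pairwise disjoint and $\delta_1,\delta_2,\delta_3,\delta_4$ nonempty; - $\Delta_1$ consists of the inequalities $J(h;\{i\},\{j\},\emptyset,\alpha)\ge 0$ with $i\ne j$ in $\mathcal N$ and $\alpha\subseteq\mathcal N\setminus\{i,j\}$; - $\Delta_2$ consists of the inequalities $J(h;\{i\},\{i\},\emptyset,\mathcal N\setminus\{i\})\ge 0$ with $i\in\mathcal N$. Then no inequality in $\Delta$ is implied by the other inequalities in $\Delta$ (that is, for each of them some $h\in\mathbb F_n$ satisfies all the others and violates it). Consequently $\Delta$ is the unique minimal set of Ingleton inequalities that characterizes $\Gamma^{\mathrm{In}}$: among the sets $S$ of Ingleton inequalities whose solution set is $\Gamma^{\mathrm{In}}$, $\Delta$ is the only one that is minimal under inclusion, and equivalently the only one in which no inequality is implied by the others. -/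

import Mathlib

namespace Ingleton

noncomputable section

/-- The real coordinate space whose coordinates are indexed by the nonempty subsets of an
`n`-element ground set. -/
abbrev FSpace (n : ℕ) : Type := {α : Finset (Fin n) // α.Nonempty} → ℝ

/-- The linear functional `h ↦ h(α)`, with the convention `h(∅) = 0`. -/
def coord {n : ℕ} (α : Finset (Fin n)) : Module.Dual ℝ (FSpace n) :=
  if hα : α.Nonempty then LinearMap.proj ⟨α, hα⟩ else 0

/-- The Ingleton term `h ↦ J(h; α₁, α₂, α₃, α₄)`, as a linear functional on `FSpace n`. -/
def term {n : ℕ} (α₁ α₂ α₃ α₄ : Finset (Fin n)) : Module.Dual ℝ (FSpace n) :=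
  coord (α₁ ∪ α₂) + coord (α₁ ∪ α₃) + coord (α₁ ∪ α₄) + coord (α₂ ∪ α₃) + coord (α₂ ∪ α₄)
    - coord α₁ - coord α₂ - coord (α₃ ∪ α₄) - coord (α₁ ∪ α₂ ∪ α₃) - coord (α₁ ∪ α₂ ∪ α₄)

/-- The conditional Ingleton term `J(h; δ₁, δ₂, δ₃, δ₄ | β)`. -/
def condTerm {n : ℕ} (δ₁ δ₂ δ₃ δ₄ β : Finset (Fin n)) : Module.Dual ℝ (FSpace n) :=
  term (δ₁ ∪ β) (δ₂ ∪ β) (δ₃ ∪ β) (δ₄ ∪ β)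

/-- A homogeneous linear inequality `f h ≥ 0` is represented by its left-hand side `f`, so that
index quadruples which give the same inequality give a single element. This is the set of all
Ingleton inequalities. -/
def inequalities (n : ℕ) : Set (Module.Dual ℝ (FSpace n)) :=
  {f | ∃ α₁ α₂ α₃ α₄ : Finset (Fin n), f = term α₁ α₂ α₃ α₄}

/-- The set of all `h` that satisfy every inequality in `S`. -/
def solutions {n : ℕ} (S : Set (Module.Dual ℝ (FSpace n))) : Set (FSpace n) :=
  {h | ∀ f ∈ S, 0 ≤ f h}

/-- The cone of all `h` whose Ingleton terms are all nonnegative. -/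
def cone (n : ℕ) : Set (FSpace n) :=
  {h | ∀ α₁ α₂ α₃ α₄ : Finset (Fin n), 0 ≤ term α₁ α₂ α₃ α₄ h}

/-- Conditional terms of pairwise disjoint sets, the first four of which are nonempty. -/
def Delta₀ (n : ℕ) : Set (Module.Dual ℝ (FSpace n)) :=
  {f | ∃ (δ : Fin 4 → Finset (Fin n)) (β : Finset (Fin n)),
    (∀ i j, i ≠ j → Disjoint (δ i) (δ j)) ∧ (∀ i, Disjoint (δ i) β) ∧ (∀ i, (δ i).Nonempty) ∧
      f = condTerm (δ 0) (δ 1) (δ 2) (δ 3) β}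

/-- Elemental inequalities for conditional mutual information. -/
def Delta₁ (n : ℕ) : Set (Module.Dual ℝ (FSpace n)) :=
  {f | ∃ (i j : Fin n) (α : Finset (Fin n)),
    i ≠ j ∧ α ⊆ Finset.univ \ {i, j} ∧ f = term {i} {j} ∅ α}

/-- Elemental inequalities for conditional entropy. -/
def Delta₂ (n : ℕ) : Set (Module.Dual ℝ (FSpace n)) :=
  {f | ∃ i : Fin n, f = term {i} {i} ∅ (Finset.univ \ {i})}

def Delta (n : ℕ) : Set (Module.Dual ℝ (FSpace n)) :=
  Delta₀ n ∪ Delta₁ n ∪ Delta₂ n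

/-- The inequality `f h ≥ 0` holds whenever all inequalities in `S` hold. -/
def ImpliedBy {n : ℕ} (f : Module.Dual ℝ (FSpace n)) (S : Set (Module.Dual ℝ (FSpace n))) : Prop :=
  ∀ h ∈ solutions S, 0 ≤ f h

/-- No member of `S` is implied by the other members of `S`. -/
def Nonredundant {n : ℕ} (S : Set (Module.Dual ℝ (FSpace n))) : Prop :=
  ∀ f ∈ S, ¬ ImpliedBy f (S \ {f})

/-- `S` is a set of Ingleton inequalities that cuts out the cone. -/
def Characterizes {n : ℕ} (S : Set (Module.Dual ℝ (FSpace n))) : Prop :=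
  S ⊆ inequalities n ∧ solutions S = cone n

end

end Ingleton

/-! Two facts carry the proof. First, every Ingleton term is a sum of members of `Delta` with
natural number coefficients (`term_mem`): pairwise intersections are absorbed into the other sets at
the cost of Shannon terms, until the four sets have the form δᵢ ∪ K with disjoint δᵢ.

Second, the members of `Delta` take only the values 0 and 1 on the matroid rank functions `meet T`
and `circ T`, and for distinct `f`, `g` in `Delta` one of these vectors has `f = 0` and `g = 1`
(`separated_of_ne`). Adding all such vectors with `f = 0` gives a point `faceSum f` at which `f`
vanishes and every other member is at least 1.

Subtracting some `meet T` with `f (meet T) = 1` makes `f` negative. An Ingleton term loses at most 1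
by this, and by integrality it is at least 1 at `faceSum f` unless it is a multiple of `f`; the only
possible multiples are 0 and `f`. So each member of `Delta` is violated by a point satisfying all
other Ingleton inequalities (`exists_violator`). Hence every characterizing set contains `Delta`,
and both uniqueness claims follow. -/

namespace Ingleton

open Finset

/-! ### Every Ingleton inequality is a sum of members of `Delta` -/

theorem term_comm_left {n : ℕ} (A B C D : Finset (Fin n)) : term A B C D = term B A C D := by
  simp only [term, union_comm B A]
  abel

theorem term_comm_right {n : ℕ} (A B C D : Finset (Fin n)) : term A B C D = term A B D C := by
  simp only [term, union_comm D C]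
  abel

theorem coord_empty {n : ℕ} : coord (∅ : Finset (Fin n)) = 0 := by
  simp [coord]

theorem term_singleton_singleton {n : ℕ} (i j : Fin n) (K : Finset (Fin n)) :
    term {i} {j} ∅ K =
      coord (insert i K) + coord (insert j K) - coord K - coord (insert i (insert j K)) := by
  have h : ({i} : Finset (Fin n)) ∪ {j} ∪ K = insert i (insert j K) := by
    ext; simp
  rw [term, h]
  simp only [union_empty, empty_union, ← insert_eq]
  abel

theorem term_singleton_self {n : ℕ} (i : Fin n) :
    term {i} {i} ∅ (univ \ {i}) = coord univ - coord (univ \ {i}) := by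
  have h : ({i} : Finset (Fin n)) ∪ univ \ {i} = univ := by
    simp
  simp only [term, union_idempotent, h, union_empty, empty_union]
  abel

/-! ### Shannon inequalities generated by the elemental ones -/

/-- Conditional mutual information as a linear functional. -/
noncomputable def mutualInfo {n : ℕ} (A B K : Finset (Fin n)) : Module.Dual ℝ (FSpace n) :=
  coord (A ∪ K) + coord (B ∪ K) - coord K - coord (A ∪ B ∪ K)

theorem mutualInfo_comm {n : ℕ} (A B K : Finset (Fin n)) :
    mutualInfo A B K = mutualInfo B A K := by
  simp only [mutualInfo, union_comm B A]
  abel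

theorem mutualInfo_of_subset {n : ℕ} {A B K : Finset (Fin n)} (h : A ⊆ K) :
    mutualInfo A B K = 0 := by
  have h1 : A ∪ K = K := union_eq_right.2 h
  have h2 : A ∪ B ∪ K = B ∪ K := by
    rw [union_comm A B, union_assoc, h1]
  rw [mutualInfo, h1, h2]
  abel

theorem mutualInfo_union_right {n : ℕ} (A B C K : Finset (Fin n)) :
    mutualInfo A (B ∪ C) K = mutualInfo A B K + mutualInfo A C (B ∪ K) := by
  have h1 : C ∪ (B ∪ K) = B ∪ C ∪ K := by ext; simp; tauto
  have h2 : A ∪ C ∪ (B ∪ K) = A ∪ (B ∪ C) ∪ K := by ext; simp; tauto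
  have h3 : A ∪ (B ∪ K) = A ∪ B ∪ K := by ext; simp
  simp only [mutualInfo, h1, h2, h3]
  abel

/-- The hypothesis excludes `i = j ∉ K`, where the expression is a conditional entropy and needs
`Delta₂`. The chain rule then extends the result to sets. -/
theorem mutualInfo_singleton_mem {n : ℕ} (i j : Fin n) (K : Finset (Fin n)) (hij : i = j → i ∈ K) :
    mutualInfo {i} {j} K ∈ AddSubmonoid.closure (Delta n) := by
  by_cases hi : i ∈ K
  · rw [mutualInfo_of_subset (by simpa using hi)]
    exact zero_mem _
  by_cases hj : j ∈ K
  · rw [mutualInfo_comm, mutualInfo_of_subset (by simpa using hj)]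
    exact zero_mem _
  refine AddSubmonoid.subset_closure (Or.inl (Or.inr ⟨i, j, K, fun h => hi (hij h), ?_, ?_⟩))
  · intro x hx
    simp only [mem_sdiff, mem_univ, mem_insert, mem_singleton, true_and]
    rintro (rfl | rfl)
    exacts [hi hx, hj hx]
  · have h : ({i} : Finset (Fin n)) ∪ {j} ∪ K = insert i (insert j K) := by
      ext; simp
    rw [term_singleton_singleton, mutualInfo, h, ← insert_eq, ← insert_eq]

theorem mutualInfo_singleton_left_mem {n : ℕ} (i : Fin n) (B K : Finset (Fin n))
    (h : i ∈ B → i ∈ K) : mutualInfo {i} B K ∈ AddSubmonoid.closure (Delta n) := by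
  induction B using Finset.induction_on generalizing K with
  | empty =>
    rw [mutualInfo_comm, mutualInfo_of_subset (empty_subset _)]
    exact zero_mem _
  | insert j B _ ih =>
    rw [insert_eq, mutualInfo_union_right]
    refine add_mem (mutualInfo_singleton_mem _ _ _ fun e => h (by simp [e])) (ih _ fun e => ?_)
    exact mem_union_right _ (h (mem_insert_of_mem e))

theorem mutualInfo_mem {n : ℕ} (A B K : Finset (Fin n)) (h : A ∩ B ⊆ K) :
    mutualInfo A B K ∈ AddSubmonoid.closure (Delta n) := by
  induction A using Finset.induction_on generalizing K with
  | empty =>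
    rw [mutualInfo_of_subset (empty_subset _)]
    exact zero_mem _
  | insert i A _ ih =>
    rw [insert_eq, mutualInfo_comm, mutualInfo_union_right, mutualInfo_comm, mutualInfo_comm B]
    refine add_mem (mutualInfo_singleton_left_mem _ _ _ fun e => h (by simp [e]))
      (ih _ fun x hx => mem_union_right _ (h ?_))
    simp only [mem_inter, mem_insert] at hx ⊢
    tauto

theorem coord_insert_sub_mem {n : ℕ} (i : Fin n) (A : Finset (Fin n)) :
    coord (insert i A) - coord A ∈ AddSubmonoid.closure (Delta n) := by
  by_cases hi : i ∈ A
  · rw [insert_eq_of_mem hi, sub_self]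
    exact zero_mem _
  -- With N the ground set: h(i ∪ A) - h(A) = I(i; N∖i | A) + (h(N) - h(N∖i)).
  have h1 := mutualInfo_singleton_left_mem i (univ \ {i}) A (by simp)
  have h2 : term {i} {i} ∅ (univ \ {i}) ∈ AddSubmonoid.closure (Delta n) :=
    AddSubmonoid.subset_closure (Or.inr ⟨i, rfl⟩)
  have h3 : univ \ {i} ∪ A = univ \ {i} := by
    ext x; simp only [mem_union, mem_sdiff, mem_univ, mem_singleton, true_and]
    refine ⟨fun h => h.elim id fun h e => hi (e ▸ h), Or.inl⟩
  have h4 : ({i} : Finset (Fin n)) ∪ univ \ {i} ∪ A = univ := by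
    simp
  rw [mutualInfo, h3, h4, ← insert_eq] at h1
  rw [term_singleton_self] at h2
  convert add_mem h1 h2 using 1
  abel

theorem coord_union_sub_mem {n : ℕ} (A B : Finset (Fin n)) :
    coord (A ∪ B) - coord A ∈ AddSubmonoid.closure (Delta n) := by
  induction B using Finset.induction_on with
  | empty =>
    rw [union_empty, sub_self]
    exact zero_mem _
  | insert i B _ ih =>
    rw [union_insert]
    convert add_mem (coord_insert_sub_mem i (A ∪ B)) ih using 1
    abel

/-! ### Absorbing intersections into the other sets -/

theorem term_mem_of_union_right {n : ℕ} {A B C D : Finset (Fin n)} (E : Finset (Fin n))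
    (hA : E ⊆ A) (hB : E ⊆ B)
    (h : term A B (C ∪ E) (D ∪ E) ∈ AddSubmonoid.closure (Delta n)) :
    term A B C D ∈ AddSubmonoid.closure (Delta n) := by
  -- As E lies in A and B, enlarging C and D changes only the summand -h(C ∪ D).
  convert add_mem h (coord_union_sub_mem (C ∪ D) E) using 1
  have hA' (X) : A ∪ (X ∪ E) = A ∪ X := by grind
  have hB' (X) : B ∪ (X ∪ E) = B ∪ X := by grind
  have h1 : C ∪ E ∪ (D ∪ E) = C ∪ D ∪ E := by grind
  have h2 (X) : A ∪ B ∪ (X ∪ E) = A ∪ B ∪ X := by grind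
  simp only [term, hA', hB', h1, h2]
  abel

theorem term_mem_of_union_cross {n : ℕ} {A B C D : Finset (Fin n)} (E : Finset (Fin n))
    (hA : E ⊆ A) (hC : E ⊆ C)
    (h : term A (B ∪ E) C (D ∪ E) ∈ AddSubmonoid.closure (Delta n)) :
    term A B C D ∈ AddSubmonoid.closure (Delta n) := by
  -- The terms differ by I(D; E | B). Since D ∩ E need not lie in B, this is split into a mutual
  -- information given B ∪ (D ∩ E) and an increment of h.
  have hm := mutualInfo_mem D E (B ∪ (D ∩ E)) (by grind)
  have hm' := coord_union_sub_mem B (D ∩ E)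
  convert add_mem h (add_mem hm hm') using 1
  have h1 : A ∪ (B ∪ E) = A ∪ B := by grind
  have h2 : A ∪ (D ∪ E) = A ∪ D := by grind
  have h3 : B ∪ E ∪ C = B ∪ C := by grind
  have h4 : B ∪ E ∪ (D ∪ E) = B ∪ D ∪ E := by grind
  have h5 : C ∪ (D ∪ E) = C ∪ D := by grind
  have h6 : A ∪ B ∪ (D ∪ E) = A ∪ B ∪ D := by grind
  have h7 : D ∪ (B ∪ D ∩ E) = B ∪ D := by grind
  have h8 : E ∪ (B ∪ D ∩ E) = B ∪ E := by grind
  have h9 : D ∪ E ∪ (B ∪ D ∩ E) = B ∪ D ∪ E := by grind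
  simp only [term, mutualInfo, h1, h2, h3, h4, h5, h6, h7, h8, h9]
  abel

theorem term_mem_of_union_left {n : ℕ} {A B C D : Finset (Fin n)} (E : Finset (Fin n))
    (hC : E ⊆ C) (hD : E ⊆ D)
    (h : term (A ∪ E) (B ∪ E) C D ∈ AddSubmonoid.closure (Delta n)) :
    term A B C D ∈ AddSubmonoid.closure (Delta n) := by
  -- The difference is I(B; E | A) + h(B ∪ E) - h(B), the first summand being split at A ∪ (B ∩ E).
  have hm := mutualInfo_mem B E (A ∪ (B ∩ E)) (by grind)
  have hm' := coord_union_sub_mem A (B ∩ E)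
  have hm'' := coord_union_sub_mem B E
  convert add_mem (add_mem h hm'') (add_mem hm hm') using 1
  have h1 : A ∪ E ∪ (B ∪ E) = A ∪ B ∪ E := by grind
  have h2 (X) : X ∪ E ∪ C = X ∪ C := by grind
  have h3 (X) : X ∪ E ∪ D = X ∪ D := by grind
  have h7 : B ∪ (A ∪ B ∩ E) = A ∪ B := by grind
  have h8 : E ∪ (A ∪ B ∩ E) = A ∪ E := by grind
  have h9 : B ∪ E ∪ (A ∪ B ∩ E) = A ∪ B ∪ E := by grind
  simp only [term, mutualInfo, h1, h2, h3, h7, h8, h9]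
  abel

/-- Degenerate case: the term collapses to I(C; D | K). -/
theorem term_mem_of_subset_left {n : ℕ} {A B C D K : Finset (Fin n)} (hA : A = K)
    (hB : K ⊆ B) (hC : K ⊆ C) (hD : K ⊆ D) (hCD : C ∩ D ⊆ K) :
    term A B C D ∈ AddSubmonoid.closure (Delta n) := by
  subst hA
  convert mutualInfo_mem C D A hCD using 1
  have h1 : A ∪ B = B := by grind
  have h2 : A ∪ C = C := by grind
  have h3 : A ∪ D = D := by grind
  have h4 : C ∪ D ∪ A = C ∪ D := by grind
  simp only [term, mutualInfo, union_comm C A, union_comm D A, h1, h2, h3, h4]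
  abel

/-- Degenerate case: the term collapses to I(A; B | D). -/
theorem term_mem_of_subset_right {n : ℕ} {A B C D K : Finset (Fin n)} (hC : C = K)
    (hA : K ⊆ A) (hB : K ⊆ B) (hD : K ⊆ D) (h : A ∩ B ⊆ K) :
    term A B C D ∈ AddSubmonoid.closure (Delta n) := by
  subst hC
  convert mutualInfo_mem A B D (by grind) using 1
  have h1 : A ∪ B ∪ C = A ∪ B := by grind
  have h2 : A ∪ C = A := by grind
  have h3 : B ∪ C = B := by grind
  have h4 : C ∪ D = D := by grind
  simp only [term, mutualInfo, h1, h2, h3, h4]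
  abel

theorem term_union_mem {n : ℕ} (A B C D K : Finset (Fin n)) (hAB : Disjoint A B)
    (hAC : Disjoint A C) (hAD : Disjoint A D) (hBC : Disjoint B C) (hBD : Disjoint B D)
    (hCD : Disjoint C D) (hA : Disjoint A K) (hB : Disjoint B K) (hC : Disjoint C K)
    (hD : Disjoint D K) :
    term (A ∪ K) (B ∪ K) (C ∪ K) (D ∪ K) ∈ AddSubmonoid.closure (Delta n) := by
  have hl (X Y : Finset (Fin n)) (h : Disjoint X Y) : (X ∪ K) ∩ (Y ∪ K) ⊆ K := by
    rw [disjoint_left] at h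
    grind
  have he (X : Finset (Fin n)) (h : ¬ X.Nonempty) : X ∪ K = K := by
    rw [not_nonempty_iff_eq_empty.1 h, empty_union]
  have hs (X : Finset (Fin n)) : K ⊆ X ∪ K := subset_union_right
  by_cases h0 : A.Nonempty
  swap
  · exact term_mem_of_subset_left (he _ h0) (hs _) (hs _) (hs _) (hl _ _ hCD)
  by_cases h1 : B.Nonempty
  swap
  · rw [term_comm_left]
    exact term_mem_of_subset_left (he _ h1) (hs _) (hs _) (hs _) (hl _ _ hCD)
  by_cases h2 : C.Nonempty
  swap
  · exact term_mem_of_subset_right (he _ h2) (hs _) (hs _) (hs _) (hl _ _ hAB)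
  by_cases h3 : D.Nonempty
  swap
  · rw [term_comm_right]
    exact term_mem_of_subset_right (he _ h3) (hs _) (hs _) (hs _) (hl _ _ hAB)
  refine AddSubmonoid.subset_closure (Or.inl (Or.inl ⟨![A, B, C, D], K, ?_, ?_, ?_, rfl⟩))
  · intro i j hij
    fin_cases i <;> fin_cases j <;>
      first | exact absurd rfl hij | assumption | (apply Disjoint.symm; assumption)
  · intro i
    fin_cases i <;> assumption
  · intro i
    fin_cases i <;> assumption

theorem term_mem {n : ℕ} (A B C D : Finset (Fin n)) :
    term A B C D ∈ AddSubmonoid.closure (Delta n) := by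
  -- The six intersections of the original sets are absorbed in turn. Each set X thereby becomes X ∪
  -- K, with K the union of all six, and the sets X ∖ K are pairwise disjoint.
  refine term_mem_of_union_right (A ∩ B) (by grind) (by grind) ?_
  refine term_mem_of_union_left (C ∩ D) (by grind) (by grind) ?_
  refine term_mem_of_union_cross (A ∩ C) (by grind) (by grind) ?_
  rw [term_comm_left]
  refine term_mem_of_union_cross (B ∩ C) (by grind) (by grind) ?_
  rw [term_comm_right]
  refine term_mem_of_union_cross (B ∩ D) (by grind) (by grind) ?_
  rw [term_comm_left]
  refine term_mem_of_union_cross (A ∩ D) (by grind) (by grind) ?_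
  rw [term_comm_right]
  let K := (A ∩ B) ∪ (C ∩ D) ∪ (A ∩ C) ∪ (B ∩ C) ∪ (B ∩ D) ∪ (A ∩ D)
  have h := term_union_mem (A \ K) (B \ K) (C \ K) (D \ K) K
  have hd (X Y : Finset (Fin n)) (h : X ∩ Y ⊆ K) : Disjoint (X \ K) (Y \ K) := by
    rw [disjoint_left]
    grind
  convert h (hd _ _ (by grind)) (hd _ _ (by grind)) (hd _ _ (by grind)) (hd _ _ (by grind))
    (hd _ _ (by grind)) (hd _ _ (by grind)) sdiff_disjoint sdiff_disjoint sdiff_disjoint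
    sdiff_disjoint using 1
  congr 1 <;> grind

/-! ### Test vectors -/

/-- The rank function of a matroid whose nonloops, the elements of `T`, are all parallel. -/
noncomputable def meet {n : ℕ} (T : Finset (Fin n)) : FSpace n :=
  fun α => if ∃ e ∈ T, e ∈ α.1 then 1 else 0

/-- The indicator function of the nonempty sets that contain `T`. -/
noncomputable def above {n : ℕ} (T : Finset (Fin n)) : FSpace n :=
  fun α => if T ⊆ α.1 then 1 else 0

/-- The rank function of a matroid whose only circuit is `T`, all other elements being loops. -/
noncomputable def circ {n : ℕ} (T : Finset (Fin n)) : FSpace n :=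
  ∑ e ∈ T, meet {e} - above T

theorem coord_meet {n : ℕ} (A T : Finset (Fin n)) :
    coord A (meet T) = if ∃ e ∈ T, e ∈ A then 1 else 0 := by
  by_cases hA : A.Nonempty
  · simp [coord, hA, meet]
  · simp [not_nonempty_iff_eq_empty.1 hA, coord_empty]

/-- For `T = ∅` the formula would fail at `A = ∅`, where `coord` is 0 by convention. -/
theorem coord_above {n : ℕ} (A T : Finset (Fin n)) (hT : T.Nonempty) :
    coord A (above T) = if T ⊆ A then 1 else 0 := by
  by_cases hA : A.Nonempty
  · simp [coord, hA, above]
  · simp [not_nonempty_iff_eq_empty.1 hA, coord_empty, hT.ne_empty]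

/-- Bounds the loss when `meet T` is subtracted from a face point. The value depends only on which
of the four sets meet `T`. -/
theorem term_meet_le_one {n : ℕ} (A B C D T : Finset (Fin n)) : term A B C D (meet T) ≤ 1 := by
  simp only [term, LinearMap.add_apply, LinearMap.sub_apply, coord_meet, mem_union, and_or_left,
    exists_or]
  by_cases hA : ∃ e ∈ T, e ∈ A <;> by_cases hB : ∃ e ∈ T, e ∈ B <;>
    by_cases hC : ∃ e ∈ T, e ∈ C <;> by_cases hD : ∃ e ∈ T, e ∈ D <;>
    simp only [hA, hB, hC, hD, if_true, if_false, true_or, or_true, or_self] <;> norm_num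

/-! A member of `Delta₀` is given by a colouring of the ground set: the colours `0, 1, 2, 3` are
the four nonempty sets, `4` is the conditioning set and `5` the rest. -/

/-- The elements coloured `i`, together with the conditioning set. -/
def cls {n : ℕ} (c : Fin n → Fin 6) (i : Fin 6) : Finset (Fin n) :=
  univ.filter fun e => c e = i ∨ c e = 4

/-- The Ingleton term of a colouring. -/
noncomputable def colTerm {n : ℕ} (c : Fin n → Fin 6) : Module.Dual ℝ (FSpace n) :=
  term (cls c 0) (cls c 1) (cls c 2) (cls c 3)

/-- The colour sets of `T` for which a colouring's term is nonzero on `meet T`. -/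
def MeetBad (P : Finset (Fin 6)) : Prop :=
  4 ∉ P ∧ ((0 ∈ P ∧ 1 ∈ P ∧ 2 ∉ P ∧ 3 ∉ P) ∨ (2 ∈ P ∧ 3 ∈ P ∧ ¬(0 ∈ P ∧ 1 ∈ P)))

/-- The colour sets of `T` for which a colouring's term is nonzero on `circ T`. -/
def CircBad (P : Finset (Fin 6)) : Prop :=
  5 ∉ P ∧ ((0 ∈ P ∧ 1 ∈ P ∧ ¬(2 ∈ P ∧ 3 ∈ P)) ∨ (2 ∈ P ∧ 3 ∈ P ∧ 0 ∉ P ∧ 1 ∉ P))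

instance : DecidablePred MeetBad := fun _ => by unfold MeetBad; infer_instance

instance : DecidablePred CircBad := fun _ => by unfold CircBad; infer_instance

theorem exists_mem_cls {n : ℕ} (c : Fin n → Fin 6) (i : Fin 6) (T : Finset (Fin n)) :
    (∃ e ∈ T, e ∈ cls c i) ↔ i ∈ T.image c ∨ 4 ∈ T.image c := by
  simp only [cls, mem_filter, mem_univ, true_and, mem_image, and_or_left, exists_or]

theorem colTerm_meet {n : ℕ} (c : Fin n → Fin 6) (T : Finset (Fin n)) :
    colTerm c (meet T) = if MeetBad (T.image c) then 1 else 0 := by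
  simp only [colTerm, term, LinearMap.add_apply, LinearMap.sub_apply, coord_meet, mem_union,
    and_or_left, exists_or, exists_mem_cls, MeetBad]
  generalize T.image c = P
  by_cases h0 : (0 : Fin 6) ∈ P <;> by_cases h1 : (1 : Fin 6) ∈ P <;>
    by_cases h2 : (2 : Fin 6) ∈ P <;> by_cases h3 : (3 : Fin 6) ∈ P <;>
    by_cases h4 : (4 : Fin 6) ∈ P <;>
    simp only [h0, h1, h2, h3, h4, if_true, if_false, or_true, or_self, not_true,
      not_false_iff, and_true, and_false, or_false] <;> norm_num

theorem colTerm_above {n : ℕ} (c : Fin n → Fin 6) (T : Finset (Fin n)) (hT : T.Nonempty) :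
    colTerm c (above T) = if CircBad (T.image c) then -1 else 0 := by
  -- Each set in the term is a union of colour classes, so it contains `T` exactly when `T` avoids
  -- the complementary colours `Q`.
  have key (A : Finset (Fin n)) (Q : Finset (Fin 6)) (h : ∀ e, e ∈ A ↔ c e ∉ Q) :
      T ⊆ A ↔ ∀ i ∈ Q, i ∉ T.image c := by
    simp only [subset_iff, mem_image, h]
    exact ⟨fun H i hi ⟨e, he, hc⟩ => H he (hc ▸ hi), fun H e he hc => H _ hc ⟨e, he, rfl⟩⟩
  have m (e : Fin n) (i : Fin 6) : e ∈ cls c i ↔ c e = i ∨ c e = 4 := by simp [cls]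
  have k1 := key (cls c 0) {1, 2, 3, 5} fun e => by
    rw [m]; generalize c e = a; revert a; decide
  have k2 := key (cls c 1) {0, 2, 3, 5} fun e => by
    rw [m]; generalize c e = a; revert a; decide
  have k12 := key (cls c 0 ∪ cls c 1) {2, 3, 5} fun e => by
    rw [mem_union, m, m]; generalize c e = a; revert a; decide
  have k13 := key (cls c 0 ∪ cls c 2) {1, 3, 5} fun e => by
    rw [mem_union, m, m]; generalize c e = a; revert a; decide
  have k14 := key (cls c 0 ∪ cls c 3) {1, 2, 5} fun e => by
    rw [mem_union, m, m]; generalize c e = a; revert a; decide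
  have k23 := key (cls c 1 ∪ cls c 2) {0, 3, 5} fun e => by
    rw [mem_union, m, m]; generalize c e = a; revert a; decide
  have k24 := key (cls c 1 ∪ cls c 3) {0, 2, 5} fun e => by
    rw [mem_union, m, m]; generalize c e = a; revert a; decide
  have k34 := key (cls c 2 ∪ cls c 3) {0, 1, 5} fun e => by
    rw [mem_union, m, m]; generalize c e = a; revert a; decide
  have k123 := key (cls c 0 ∪ cls c 1 ∪ cls c 2) {3, 5} fun e => by
    rw [mem_union, mem_union, m, m, m]; generalize c e = a; revert a; decide
  have k124 := key (cls c 0 ∪ cls c 1 ∪ cls c 3) {2, 5} fun e => by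
    rw [mem_union, mem_union, m, m, m]; generalize c e = a; revert a; decide
  simp only [colTerm, term, LinearMap.add_apply, LinearMap.sub_apply, coord_above _ _ hT, k1, k2,
    k12, k13, k14, k23, k24, k34, k123, k124, CircBad, forall_mem_insert, mem_singleton,
    forall_eq]
  generalize T.image c = P
  by_cases h0 : (0 : Fin 6) ∈ P <;> by_cases h1 : (1 : Fin 6) ∈ P <;>
    by_cases h2 : (2 : Fin 6) ∈ P <;> by_cases h3 : (3 : Fin 6) ∈ P <;>
    by_cases h5 : (5 : Fin 6) ∈ P <;>
    simp only [h0, h1, h2, h3, h5, if_true, if_false, or_true, or_self, not_true,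
      not_false_iff, and_true, and_false, or_false] <;> norm_num

theorem colTerm_circ {n : ℕ} (c : Fin n → Fin 6) (T : Finset (Fin n)) (hT : T.Nonempty) :
    colTerm c (circ T) = if CircBad (T.image c) then 1 else 0 := by
  have h (e : Fin n) : colTerm c (meet {e}) = 0 := by
    rw [colTerm_meet, image_singleton, if_neg]
    generalize c e = a
    revert a
    decide
  rw [circ, map_sub, map_sum, colTerm_above c T hT, sum_eq_zero fun e _ => h e]
  split_ifs <;> norm_num

theorem elemental_meet {n : ℕ} {i j : Fin n} {K : Finset (Fin n)} (T : Finset (Fin n)) :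
    term {i} {j} ∅ K (meet T) = if i ∈ T ∧ j ∈ T ∧ Disjoint T K then 1 else 0 := by
  have hK : Disjoint T K ↔ ¬ ∃ e ∈ T, e ∈ K := by simp [disjoint_left]
  simp only [term_singleton_singleton, LinearMap.add_apply, LinearMap.sub_apply, coord_meet,
    mem_insert, and_or_left, exists_or, exists_eq_right, hK]
  by_cases h0 : i ∈ T <;> by_cases h1 : j ∈ T <;> by_cases h2 : ∃ e ∈ T, e ∈ K <;>
    simp [h0, h1, h2]

theorem elemental_above {n : ℕ} {i j : Fin n} {K : Finset (Fin n)} (hij : i ≠ j) (hi : i ∉ K)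
    (hj : j ∉ K) (T : Finset (Fin n)) (hT : T.Nonempty) :
    term {i} {j} ∅ K (above T) =
      if i ∈ T ∧ j ∈ T ∧ T ⊆ insert i (insert j K) then -1 else 0 := by
  simp only [term_singleton_singleton, LinearMap.add_apply, LinearMap.sub_apply,
    coord_above _ _ hT]
  have h1 : T ⊆ insert i K ↔ T ⊆ insert i (insert j K) ∧ j ∉ T := by grind
  have h2 : T ⊆ insert j K ↔ T ⊆ insert i (insert j K) ∧ i ∉ T := by grind
  have h3 : T ⊆ K ↔ T ⊆ insert i (insert j K) ∧ i ∉ T ∧ j ∉ T := by grind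
  simp only [h1, h2, h3]
  by_cases h0 : i ∈ T <;> by_cases h1 : j ∈ T <;> by_cases h2 : T ⊆ insert i (insert j K) <;>
    simp [h0, h1, h2]

theorem elemental_circ {n : ℕ} {i j : Fin n} {K : Finset (Fin n)} (hij : i ≠ j) (hi : i ∉ K)
    (hj : j ∉ K) (T : Finset (Fin n)) (hT : T.Nonempty) :
    term {i} {j} ∅ K (circ T) =
      if i ∈ T ∧ j ∈ T ∧ T ⊆ insert i (insert j K) then 1 else 0 := by
  have h (e : Fin n) : term {i} {j} ∅ K (meet {e}) = 0 := by
    rw [elemental_meet, if_neg]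
    rintro ⟨h1, h2, -⟩
    exact hij ((mem_singleton.1 h1).trans (mem_singleton.1 h2).symm)
  rw [circ, map_sub, map_sum, elemental_above hij hi hj T hT, sum_eq_zero fun e _ => h e]
  split_ifs <;> norm_num

theorem condEntropy_meet {n : ℕ} (i : Fin n) (T : Finset (Fin n)) :
    term {i} {i} ∅ (univ \ {i}) (meet T) = if T = {i} then 1 else 0 := by
  simp only [term_singleton_self, LinearMap.sub_apply, coord_meet]
  by_cases hT : T = {i}
  · simp [hT]
  · rw [if_neg hT]
    by_cases hx : ∃ e ∈ T, e ∈ univ \ {i}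
    · have hy : ∃ e ∈ T, e ∈ univ := hx.imp fun e h => ⟨h.1, mem_univ e⟩
      simp only [hx, hy, if_true, sub_self]
    · have hy : ¬ ∃ e ∈ T, e ∈ univ := by
        rintro ⟨e, he, -⟩
        have hs (x) (h : x ∈ T) : x = i := by
          by_contra hne
          exact hx ⟨x, h, by simpa using hne⟩
        exact hT (eq_singleton_iff_unique_mem.2 ⟨hs e he ▸ he, hs⟩)
      simp only [hx, hy, if_false, sub_self]

/-- An element of a circuit is not a coloop, and the elements outside `T` are loops. -/
theorem condEntropy_circ {n : ℕ} (i : Fin n) (T : Finset (Fin n)) (hT : T.Nonempty) :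
    term {i} {i} ∅ (univ \ {i}) (circ T) = 0 := by
  rw [circ, map_sub, map_sum]
  simp only [condEntropy_meet, singleton_inj, sum_ite_eq']
  simp only [term_singleton_self, LinearMap.sub_apply, coord_above _ _ hT, subset_univ, if_true]
  by_cases h : i ∈ T
  · have : ¬ T ⊆ univ \ {i} := fun hs => by simpa using hs h
    simp [h, this]
  · have : T ⊆ univ \ {i} := fun x hx => by
      simp only [mem_sdiff, mem_univ, mem_singleton, true_and]
      exact fun e => h (e ▸ hx)
    simp [h, this]

/-! ### Test vectors separate the members of `Delta` -/

theorem exists_colTerm {n : ℕ} {f : Module.Dual ℝ (FSpace n)} (hf : f ∈ Delta₀ n) :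
    ∃ c : Fin n → Fin 6, (∀ i < 4, ∃ e, c e = i) ∧ f = colTerm c := by
  obtain ⟨δ, β, hδ, hβ, hne, rfl⟩ := hf
  have d (i j) (h : i ≠ j) (e) (hi : e ∈ δ i) (hj : e ∈ δ j) : False :=
    disjoint_left.1 (hδ i j h) hi hj
  have d' (i) (e) (hi : e ∈ δ i) (hb : e ∈ β) : False := disjoint_left.1 (hβ i) hi hb
  let c : Fin n → Fin 6 := fun e => if e ∈ δ 0 then 0 else if e ∈ δ 1 then 1 else
    if e ∈ δ 2 then 2 else if e ∈ δ 3 then 3 else if e ∈ β then 4 else 5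
  have h0 (e) : c e = 0 ↔ e ∈ δ 0 := by
    simp only [c]; split_ifs <;> simp_all
  have h1 (e) : c e = 1 ↔ e ∈ δ 1 := by
    have := d 0 1 (by decide) e
    simp only [c]; split_ifs <;> simp_all
  have h2 (e) : c e = 2 ↔ e ∈ δ 2 := by
    have := d 0 2 (by decide) e
    have := d 1 2 (by decide) e
    simp only [c]; split_ifs <;> simp_all
  have h3 (e) : c e = 3 ↔ e ∈ δ 3 := by
    have := d 0 3 (by decide) e
    have := d 1 3 (by decide) e
    have := d 2 3 (by decide) e
    simp only [c]; split_ifs <;> simp_all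
  have h4 (e) : c e = 4 ↔ e ∈ β := by
    have := d' 0 e
    have := d' 1 e
    have := d' 2 e
    have := d' 3 e
    simp only [c]; split_ifs <;> simp_all
  refine ⟨c, fun i hi => ?_, ?_⟩
  · obtain rfl | rfl | rfl | rfl : i = 0 ∨ i = 1 ∨ i = 2 ∨ i = 3 := by revert i; decide
    · exact (hne 0).imp fun e he => (h0 e).2 he
    · exact (hne 1).imp fun e he => (h1 e).2 he
    · exact (hne 2).imp fun e he => (h2 e).2 he
    · exact (hne 3).imp fun e he => (h3 e).2 he
  · rw [condTerm, colTerm]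
    congr 1 <;> ext e <;> simp [cls, h0, h1, h2, h3, h4]

/-! ### Recovering a colouring from its test vectors, up to symmetry -/

theorem cls_comp {n : ℕ} (σ : Equiv.Perm (Fin 6)) (hσ : σ 4 = 4) (c : Fin n → Fin 6) (i : Fin 6) :
    cls (σ ∘ c) (σ i) = cls c i := by
  ext e
  simp only [cls, mem_filter, mem_univ, true_and, Function.comp_apply, σ.injective.eq_iff]
  rw [← hσ, σ.injective.eq_iff, hσ]

theorem colTerm_swap_left {n : ℕ} (c : Fin n → Fin 6) :
    colTerm (Equiv.swap 0 1 ∘ c) = colTerm c := by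
  have h := cls_comp (Equiv.swap 0 1) (by decide) c
  rw [colTerm, colTerm, term_comm_left, ← h 0, ← h 1, ← h 2, ← h 3]
  rfl

theorem colTerm_swap_right {n : ℕ} (c : Fin n → Fin 6) :
    colTerm (Equiv.swap 2 3 ∘ c) = colTerm c := by
  have h := cls_comp (Equiv.swap 2 3) (by decide) c
  rw [colTerm, colTerm, term_comm_right, ← h 0, ← h 1, ← h 2, ← h 3]
  rfl

theorem meetBad_swap (P : Finset (Fin 6)) :
    (MeetBad (P.image (Equiv.swap 0 1)) ↔ MeetBad P) ∧
      (MeetBad (P.image (Equiv.swap 2 3)) ↔ MeetBad P) := by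
  revert P; decide

theorem circBad_swap (P : Finset (Fin 6)) :
    (CircBad (P.image (Equiv.swap 0 1)) ↔ CircBad P) ∧
      (CircBad (P.image (Equiv.swap 2 3)) ↔ CircBad P) := by
  revert P; decide

/-- Every test vector on which `colTerm d` is nonzero is one on which `colTerm c` is nonzero. -/
def Dominates {n : ℕ} (c d : Fin n → Fin 6) : Prop :=
  ∀ T : Finset (Fin n), T.Nonempty →
    (MeetBad (T.image d) → MeetBad (T.image c)) ∧ (CircBad (T.image d) → CircBad (T.image c))

theorem Dominates.swap_left {n : ℕ} {c d : Fin n → Fin 6} (h : Dominates c d) :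
    Dominates (Equiv.swap 0 1 ∘ c) d := fun T hT => by
  rw [← image_image, (meetBad_swap _).1, (circBad_swap _).1]
  exact h T hT

theorem Dominates.swap_right {n : ℕ} {c d : Fin n → Fin 6} (h : Dominates c d) :
    Dominates (Equiv.swap 2 3 ∘ c) d := fun T hT => by
  rw [← image_image, (meetBad_swap _).2, (circBad_swap _).2]
  exact h T hT

/-- Once the colourings agree on one representative of each colour 0 to 3, a few test sets made of
`e` and representatives determine the colour of `e`; this is a check over pairs of colours. -/
theorem Dominates.eq {n : ℕ} {c d : Fin n → Fin 6} (h : Dominates c d) {x y z w : Fin n}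
    (hx : d x = 0) (hy : d y = 1) (hz : d z = 2) (hw : d w = 3)
    (hx' : c x = 0) (hy' : c y = 1) (hz' : c z = 2) (hw' : c w = 3) : c = d := by
  funext e
  have h1 := h {x, y, e} (insert_nonempty _ _)
  have h2 := h {z, w, e} (insert_nonempty _ _)
  have h3 := (h {z, w, x, e} (insert_nonempty _ _)).1
  have h4 := (h {z, w, y, e} (insert_nonempty _ _)).1
  have h5 := (h {x, y, z, e} (insert_nonempty _ _)).2
  have h6 := (h {x, y, w, e} (insert_nonempty _ _)).2
  simp only [image_insert, image_singleton, hx, hy, hz, hw, hx', hy', hz', hw'] at h1 h2 h3 h4 h5 h6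
  generalize c e = a at *
  generalize d e = b at *
  clear hx hy hz hw hx' hy' hz' hw'
  revert a b
  decide

/-- The test sets `{x, y}` and `{z, w}` force each pair to get the colours {0, 1} or {2, 3} under
`c`. Three wrong combinations are excluded. If the pairs are exchanged, `{z, w, x}` fails. If both
get {2, 3}, `h4` and `h5` force `d p` and `d q` into {0, 1, 5}, against `h6`. If both get {0, 1},
`h7` and `h8` force `d r` and `d s` into {2, 3, 4}, against `h9`. -/
theorem Dominates.left_right {n : ℕ} {c d : Fin n → Fin 6} (h : Dominates c d)
    (hc : ∀ i < 4, ∃ e, c e = i) {x y z w : Fin n}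
    (hx : d x = 0) (hy : d y = 1) (hz : d z = 2) (hw : d w = 3) :
    ((c x = 0 ∧ c y = 1) ∨ (c x = 1 ∧ c y = 0)) ∧ ((c z = 2 ∧ c w = 3) ∨ (c z = 3 ∧ c w = 2)) := by
  obtain ⟨p, hp⟩ := hc 0 (by decide)
  obtain ⟨q, hq⟩ := hc 1 (by decide)
  obtain ⟨r, hr⟩ := hc 2 (by decide)
  obtain ⟨s, hs⟩ := hc 3 (by decide)
  have h1 := (h {x, y} (insert_nonempty _ _)).1
  have h2 := (h {z, w} (insert_nonempty _ _)).1
  have h3 := (h {z, w, x} (insert_nonempty _ _)).1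
  have h4 := (h {z, w, p} (insert_nonempty _ _)).2
  have h5 := (h {z, w, q} (insert_nonempty _ _)).2
  have h6 := (h {x, y, p, q} (insert_nonempty _ _)).1
  have h7 := (h {x, y, r} (insert_nonempty _ _)).1
  have h8 := (h {x, y, s} (insert_nonempty _ _)).1
  have h9 := (h {z, w, r, s} (insert_nonempty _ _)).2
  simp only [image_insert, image_singleton, hx, hy, hz, hw, hp, hq, hr, hs] at *
  have key (a b : Fin 6) (hab : MeetBad {a, b}) :
      (a = 0 ∧ b = 1) ∨ (a = 1 ∧ b = 0) ∨ (a = 2 ∧ b = 3) ∨ (a = 3 ∧ b = 2) := by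
    revert a b; decide
  generalize d p = p' at *
  generalize d q = q' at *
  generalize d r = r' at *
  generalize d s = s' at *
  clear hx hy hz hw hp hq hr hs
  have hxy : (c x = 0 ∧ c y = 1) ∨ (c x = 1 ∧ c y = 0) := by
    rcases key _ _ (h1 (by decide)) with hxy | hxy | ⟨hx, hy⟩ | ⟨hx, hy⟩
    · exact Or.inl hxy
    · exact Or.inr hxy
    all_goals
      exfalso
      clear h7 h8 h9
      rcases key _ _ (h2 (by decide)) with ⟨hz, hw⟩ | ⟨hz, hw⟩ | ⟨hz, hw⟩ | ⟨hz, hw⟩ <;>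
        rw [hx, hy] at h6 <;> rw [hx, hz, hw] at h3 <;> rw [hz, hw] at h4 h5 <;>
        clear h1 h2 <;> revert p' q' h3 <;> decide
  refine ⟨hxy, ?_⟩
  rcases key _ _ (h2 (by decide)) with ⟨hz, hw⟩ | ⟨hz, hw⟩ | hzw | hzw
  · exfalso
    rcases hxy with ⟨hx, hy⟩ | ⟨hx, hy⟩ <;> rw [hx, hy] at h7 h8 <;> rw [hz, hw] at h9 <;>
      clear h1 h2 h3 h4 h5 h6 <;> revert r' s' <;> decide
  · exfalso
    rcases hxy with ⟨hx, hy⟩ | ⟨hx, hy⟩ <;> rw [hx, hy] at h7 h8 <;> rw [hz, hw] at h9 <;>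
      clear h1 h2 h3 h4 h5 h6 <;> revert r' s' <;> decide
  · exact Or.inl hzw
  · exact Or.inr hzw

theorem Dominates.colTerm_eq {n : ℕ} {c d : Fin n → Fin 6} (h : Dominates c d)
    (hc : ∀ i < 4, ∃ e, c e = i) (hd : ∀ i < 4, ∃ e, d e = i) : colTerm c = colTerm d := by
  obtain ⟨x, hx⟩ := hd 0 (by decide)
  obtain ⟨y, hy⟩ := hd 1 (by decide)
  obtain ⟨z, hz⟩ := hd 2 (by decide)
  obtain ⟨w, hw⟩ := hd 3 (by decide)
  obtain ⟨⟨hx', hy'⟩ | ⟨hx', hy'⟩, ⟨hz', hw'⟩ | ⟨hz', hw'⟩⟩ := h.left_right hc hx hy hz hw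
  · rw [h.eq hx hy hz hw hx' hy' hz' hw']
  · rw [← colTerm_swap_right c]
    congr 1
    apply h.swap_right.eq hx hy hz hw <;> simp only [Function.comp_apply, hx', hy', hz', hw'] <;>
      decide
  · rw [← colTerm_swap_left c]
    congr 1
    apply h.swap_left.eq hx hy hz hw <;> simp only [Function.comp_apply, hx', hy', hz', hw'] <;>
      decide
  · rw [← colTerm_swap_left c, ← colTerm_swap_right]
    congr 1
    apply h.swap_left.swap_right.eq hx hy hz hw <;>
      simp only [Function.comp_apply, hx', hy', hz', hw'] <;> decide

/-! ### Separation of any two members of `Delta` -/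

theorem delta_cases {n : ℕ} {f : Module.Dual ℝ (FSpace n)} (hf : f ∈ Delta n) :
    (∃ c : Fin n → Fin 6, (∀ i < 4, ∃ e, c e = i) ∧ f = colTerm c) ∨
      (∃ i j K, i ≠ j ∧ i ∉ K ∧ j ∉ K ∧ f = term {i} {j} ∅ K) ∨
        ∃ i, f = term {i} {i} ∅ (univ \ {i}) := by
  obtain (hf | ⟨i, j, K, hij, hK, rfl⟩) | hf := hf
  · exact Or.inl (exists_colTerm hf)
  · refine Or.inr (Or.inl ⟨i, j, K, hij, fun h => ?_, fun h => ?_, rfl⟩)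
    · simpa using hK h
    · simpa using hK h
  · exact Or.inr (Or.inr hf)

theorem delta_meet {n : ℕ} {f : Module.Dual ℝ (FSpace n)} (hf : f ∈ Delta n)
    (T : Finset (Fin n)) : f (meet T) = 0 ∨ f (meet T) = 1 := by
  obtain ⟨c, -, rfl⟩ | ⟨i, j, K, -, -, -, rfl⟩ | ⟨i, rfl⟩ := delta_cases hf
  · rw [colTerm_meet]; split_ifs <;> simp
  · rw [elemental_meet]; split_ifs <;> simp
  · rw [condEntropy_meet]; split_ifs <;> simp

theorem delta_circ {n : ℕ} {f : Module.Dual ℝ (FSpace n)} (hf : f ∈ Delta n)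
    {T : Finset (Fin n)} (hT : T.Nonempty) : f (circ T) = 0 ∨ f (circ T) = 1 := by
  obtain ⟨c, -, rfl⟩ | ⟨i, j, K, hij, hi, hj, rfl⟩ | ⟨i, rfl⟩ := delta_cases hf
  · rw [colTerm_circ _ _ hT]; split_ifs <;> simp
  · rw [elemental_circ hij hi hj _ hT]; split_ifs <;> simp
  · rw [condEntropy_circ _ _ hT]; simp

theorem colTerm_meet_pair {n : ℕ} {c : Fin n → Fin 6} {x y : Fin n}
    (h : (c x = 0 ∧ c y = 1) ∨ (c x = 2 ∧ c y = 3)) : colTerm c (meet {x, y}) = 1 := by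
  rw [colTerm_meet, image_insert, image_singleton, if_pos]
  obtain ⟨hx, hy⟩ | ⟨hx, hy⟩ := h <;> rw [hx, hy] <;> decide

theorem exists_delta_meet_eq_one {n : ℕ} {f : Module.Dual ℝ (FSpace n)} (hf : f ∈ Delta n) :
    ∃ T, f (meet T) = 1 := by
  obtain ⟨c, hc, rfl⟩ | ⟨i, j, K, -, hi, hj, rfl⟩ | ⟨i, rfl⟩ := delta_cases hf
  · obtain ⟨x, hx⟩ := hc 0 (by decide)
    obtain ⟨y, hy⟩ := hc 1 (by decide)
    exact ⟨_, colTerm_meet_pair (Or.inl ⟨hx, hy⟩)⟩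
  · refine ⟨{i, j}, ?_⟩
    rw [elemental_meet, if_pos]
    simp [hi, hj]
  · exact ⟨{i}, by rw [condEntropy_meet, if_pos rfl]⟩

/-- Some test vector lies on the face of `f` but not on that of `g`. -/
def Separated {n : ℕ} (f g : Module.Dual ℝ (FSpace n)) : Prop :=
  ∃ T : Finset (Fin n), T.Nonempty ∧
    ((f (meet T) = 0 ∧ g (meet T) = 1) ∨ (f (circ T) = 0 ∧ g (circ T) = 1))

theorem Separated.of_meet {n : ℕ} {f g : Module.Dual ℝ (FSpace n)} {T : Finset (Fin n)}
    (hT : T.Nonempty) (hf : f (meet T) = 0) (hg : g (meet T) = 1) : Separated f g :=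
  ⟨T, hT, Or.inl ⟨hf, hg⟩⟩

theorem separated_colTerm {n : ℕ} {c d : Fin n → Fin 6} (hc : ∀ i < 4, ∃ e, c e = i)
    (hd : ∀ i < 4, ∃ e, d e = i) (h : colTerm c ≠ colTerm d) :
    Separated (colTerm c) (colTerm d) := by
  by_contra hs
  refine h (Dominates.colTerm_eq (fun T hT => ⟨fun hb => ?_, fun hb => ?_⟩) hc hd)
  · by_contra hb'
    exact hs ⟨T, hT, Or.inl ⟨by rw [colTerm_meet, if_neg hb'], by rw [colTerm_meet, if_pos hb]⟩⟩
  · by_contra hb'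
    exact hs ⟨T, hT, Or.inr ⟨by rw [colTerm_circ _ _ hT, if_neg hb'],
      by rw [colTerm_circ _ _ hT, if_pos hb]⟩⟩

theorem colTerm_meet_singleton {n : ℕ} (c : Fin n → Fin 6) (i : Fin n) :
    colTerm c (meet {i}) = 0 := by
  rw [colTerm_meet, image_singleton, if_neg]
  generalize c i = a
  revert a
  decide

theorem separated_colTerm_elemental {n : ℕ} {c : Fin n → Fin 6} (hc : ∀ i < 4, ∃ e, c e = i)
    {i j : Fin n} {K : Finset (Fin n)} (hij : i ≠ j) (hi : i ∉ K) (hj : j ∉ K) :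
    Separated (colTerm c) (term {i} {j} ∅ K) := by
  by_contra hs
  have hM (T : Finset (Fin n)) (h : i ∈ T ∧ j ∈ T ∧ Disjoint T K) : MeetBad (T.image c) := by
    by_contra hb
    exact hs (Separated.of_meet ⟨i, h.1⟩ (by rw [colTerm_meet, if_neg hb])
      (by rw [elemental_meet, if_pos h]))
  have hC (T : Finset (Fin n)) (h : i ∈ T ∧ j ∈ T ∧ T ⊆ insert i (insert j K)) :
      CircBad (T.image c) := by
    by_contra hb
    exact hs ⟨T, ⟨i, h.1⟩, Or.inr ⟨by rw [colTerm_circ _ _ ⟨i, h.1⟩, if_neg hb],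
      by rw [elemental_circ hij hi hj _ ⟨i, h.1⟩, if_pos h]⟩⟩
  obtain ⟨p, hp⟩ := hc 0 (by decide)
  obtain ⟨q, hq⟩ := hc 1 (by decide)
  obtain ⟨r, hr⟩ := hc 2 (by decide)
  obtain ⟨s, hs⟩ := hc 3 (by decide)
  have key (a b : Fin 6) (hab : MeetBad {a, b}) :
      (a = 0 ∧ b = 1) ∨ (a = 1 ∧ b = 0) ∨ (a = 2 ∧ b = 3) ∨ (a = 3 ∧ b = 2) := by
    revert a b; decide
  have h0 := hM {i, j} (by simp [hi, hj])
  rw [image_insert, image_singleton] at h0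
  have hmem (e) (h : ¬ MeetBad {c i, c j, c e}) : e ∈ K := by
    by_contra he
    refine h ?_
    simpa [image_insert] using hM {i, j, e} (by simp [hi, hj, he])
  have hmem₂ (e e') (h : ¬ MeetBad {c i, c j, c e, c e'}) : e ∈ K ∨ e' ∈ K := by
    by_contra! he
    refine h ?_
    simpa [image_insert] using hM {i, j, e, e'} (by simp [hi, hj, he])
  have hnmem (e) (h : ¬ CircBad {c i, c j, c e}) : e ∉ K := fun he => by
    refine h ?_
    simpa [image_insert] using hC {i, j, e} (by simp [insert_subset_iff, he])
  have hnmem₂ (e e') (h : ¬ CircBad {c i, c j, c e, c e'}) : ¬ (e ∈ K ∧ e' ∈ K) :=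
    fun ⟨he, he'⟩ => by
      refine h ?_
      simpa [image_insert] using hC {i, j, e, e'} (by simp [insert_subset_iff, he, he'])
  obtain ⟨h1, h2⟩ | ⟨h1, h2⟩ | ⟨h1, h2⟩ | ⟨h1, h2⟩ := key _ _ h0
  -- If `i`, `j` have colours 0 and 1, the `meet` vectors force `r` and `s` into `K`, but `circ {i,
  -- j, r, s}` forbids having both there.
  · exact hnmem₂ r s (by rw [h1, h2, hr, hs]; decide)
      ⟨hmem r (by rw [h1, h2, hr]; decide), hmem s (by rw [h1, h2, hs]; decide)⟩
  · exact hnmem₂ r s (by rw [h1, h2, hr, hs]; decide)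
      ⟨hmem r (by rw [h1, h2, hr]; decide), hmem s (by rw [h1, h2, hs]; decide)⟩
  -- If they have colours 2 and 3, `meet {i, j, p, q}` puts `p` or `q` into `K`, but `circ` forbids
  -- each of them.
  · exact (hmem₂ p q (by rw [h1, h2, hp, hq]; decide)).elim
      (hnmem p (by rw [h1, h2, hp]; decide)) (hnmem q (by rw [h1, h2, hq]; decide))
  · exact (hmem₂ p q (by rw [h1, h2, hp, hq]; decide)).elim
      (hnmem p (by rw [h1, h2, hp]; decide)) (hnmem q (by rw [h1, h2, hq]; decide))

theorem separated_elemental {n : ℕ} {i j x y : Fin n} {K L : Finset (Fin n)}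
    (hij : i ≠ j) (hi : i ∉ K) (hj : j ∉ K) (hxy : x ≠ y) (hx : x ∉ L) (hy : y ∉ L)
    (h : term {i} {j} ∅ K ≠ term {x} {y} ∅ L) :
    Separated (term {i} {j} ∅ K) (term {x} {y} ∅ L) := by
  by_cases hs : i ∈ ({x, y} : Finset (Fin n)) ∧ j ∈ ({x, y} : Finset (Fin n))
  swap
  · refine Separated.of_meet (insert_nonempty x {y}) ?_ ?_
    · rw [elemental_meet, if_neg]
      exact fun h => hs ⟨h.1, h.2.1⟩
    · rw [elemental_meet, if_pos]
      simp [hx, hy]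
  wlog hix : i = x generalizing x y
  · rw [term_comm_left {x}] at h ⊢
    rw [pair_comm] at hs
    refine this hxy.symm hy hx h hs ?_
    simpa [hix] using hs.1
  subst hix
  have hjy : j = y := by simpa [hij.symm] using hs.2
  subst hjy
  -- With equal pairs, the conditioning sets differ: an element of `L` outside `K` is detected by
  -- `circ`, one of `K` outside `L` by `meet`.
  by_cases hKL : K ⊆ L
  · obtain ⟨e, he, he'⟩ : ∃ e ∈ L, e ∉ K := by
      by_contra! hLK
      exact h (by rw [hKL.antisymm hLK])
    refine ⟨{i, j, e}, insert_nonempty _ _, Or.inr ⟨?_, ?_⟩⟩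
    · rw [elemental_circ hij hi hj _ (insert_nonempty _ _), if_neg]
      rintro ⟨-, -, hs⟩
      have := hs (show e ∈ ({i, j, e} : Finset (Fin n)) by simp)
      grind
    · rw [elemental_circ hij hx hy _ (insert_nonempty _ _), if_pos]
      simp [insert_subset_iff, he]
  · obtain ⟨e, he, he'⟩ := not_subset.1 hKL
    refine Separated.of_meet (T := {i, j, e}) (insert_nonempty _ _) ?_ ?_
    · rw [elemental_meet, if_neg]
      simp [he]
    · rw [elemental_meet, if_pos]
      simp [hx, hy, he']

theorem separated_of_ne {n : ℕ} {f g : Module.Dual ℝ (FSpace n)} (hf : f ∈ Delta n)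
    (hg : g ∈ Delta n) (h : f ≠ g) : Separated f g := by
  obtain ⟨c, hc, rfl⟩ | ⟨i, j, K, hij, hi, hj, rfl⟩ | ⟨i, rfl⟩ := delta_cases hf <;>
    obtain ⟨d, hd, rfl⟩ | ⟨x, y, L, hxy, hx, hy, rfl⟩ | ⟨x, rfl⟩ := delta_cases hg
  · exact separated_colTerm hc hd h
  · exact separated_colTerm_elemental hc hxy hx hy
  · exact Separated.of_meet (singleton_nonempty x) (colTerm_meet_singleton c x)
      (by rw [condEntropy_meet, if_pos rfl])
  · obtain ⟨p, hp⟩ := hd 0 (by decide)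
    obtain ⟨q, hq⟩ := hd 1 (by decide)
    obtain ⟨r, hr⟩ := hd 2 (by decide)
    obtain ⟨s, hs⟩ := hd 3 (by decide)
    -- The pairs `{p, q}` and `{r, s}` are disjoint, so at least one of them does not contain both
    -- `i` and `j`.
    by_cases hpq : i ∈ ({p, q} : Finset (Fin n)) ∧ j ∈ ({p, q} : Finset (Fin n))
    · refine Separated.of_meet (insert_nonempty r {s}) ?_
        (colTerm_meet_pair (Or.inr ⟨hr, hs⟩))
      rw [elemental_meet, if_neg]
      rintro ⟨hirs, -⟩
      have hi := hpq.1
      simp only [mem_insert, mem_singleton] at hirs hi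
      obtain rfl | rfl := hirs <;> obtain rfl | rfl := hi <;> simp_all
    · refine Separated.of_meet (insert_nonempty p {q}) ?_
        (colTerm_meet_pair (Or.inl ⟨hp, hq⟩))
      rw [elemental_meet, if_neg]
      exact fun h => hpq ⟨h.1, h.2.1⟩
  · exact separated_elemental hij hi hj hxy hx hy h
  · refine Separated.of_meet (singleton_nonempty x) ?_ (by rw [condEntropy_meet, if_pos rfl])
    rw [elemental_meet, if_neg]
    rintro ⟨h1, h2, -⟩
    exact hij ((mem_singleton.1 h1).trans (mem_singleton.1 h2).symm)
  · obtain ⟨p, hp⟩ := hd 0 (by decide)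
    obtain ⟨q, hq⟩ := hd 1 (by decide)
    refine Separated.of_meet (insert_nonempty p {q}) ?_ (colTerm_meet_pair (Or.inl ⟨hp, hq⟩))
    rw [condEntropy_meet, if_neg]
    intro he
    have h1 : p = i := by simpa using he.subset (show p ∈ ({p, q} : Finset (Fin n)) by simp)
    have h2 : q = i := by simpa using he.subset (show q ∈ ({p, q} : Finset (Fin n)) by simp)
    simp_all
  · refine Separated.of_meet (insert_nonempty x {y}) ?_
      (by rw [elemental_meet, if_pos]; simp [hx, hy])
    rw [condEntropy_meet, if_neg]
    intro he
    have h1 : x = i := by simpa using he.subset (show x ∈ ({x, y} : Finset (Fin n)) by simp)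
    have h2 : y = i := by simpa using he.subset (show y ∈ ({x, y} : Finset (Fin n)) by simp)
    exact hxy (h1.trans h2.symm)
  · refine Separated.of_meet (singleton_nonempty x) ?_ (by rw [condEntropy_meet, if_pos rfl])
    rw [condEntropy_meet, if_neg]
    intro he
    exact h (by rw [singleton_injective he])

/-! ### The main theorem -/

open Classical in
/-- The sum of all test vectors on the face of `f`. -/
noncomputable def faceSum {n : ℕ} (f : Module.Dual ℝ (FSpace n)) : FSpace n :=
  ∑ T : Finset (Fin n) with T.Nonempty,
    ((if f (meet T) = 0 then meet T else 0) + if f (circ T) = 0 then circ T else 0)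

theorem apply_faceSum_self {n : ℕ} (f : Module.Dual ℝ (FSpace n)) : f (faceSum f) = 0 := by
  rw [faceSum, map_sum]
  refine sum_eq_zero fun T _ => ?_
  rw [map_add]
  split_ifs <;> simp [*]

theorem one_le_apply_faceSum {n : ℕ} {f g : Module.Dual ℝ (FSpace n)} (hg : g ∈ Delta n)
    (h : Separated f g) : 1 ≤ g (faceSum f) := by
  have hM (T : Finset (Fin n)) : 0 ≤ g (if f (meet T) = 0 then meet T else 0) := by
    split_ifs
    · obtain h | h := delta_meet hg T <;> rw [h]; norm_num
    · rw [map_zero]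
  have hC (T : Finset (Fin n)) (hT : T.Nonempty) :
      0 ≤ g (if f (circ T) = 0 then circ T else 0) := by
    split_ifs
    · obtain h | h := delta_circ hg hT <;> rw [h]; norm_num
    · rw [map_zero]
  obtain ⟨T, hT, h⟩ := h
  rw [faceSum, map_sum]
  refine le_trans ?_ (single_le_sum (f := fun T => g ((if f (meet T) = 0 then meet T else 0) +
    if f (circ T) = 0 then circ T else 0)) (fun S hS => ?_) (mem_filter.2 ⟨mem_univ T, hT⟩))
  · have hM := hM T
    have hC := hC T hT
    obtain ⟨h1, h2⟩ | ⟨h1, h2⟩ := h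
    · rw [if_pos h1] at hM ⊢
      rw [map_add, h2]
      linarith
    · rw [if_pos h1] at hC ⊢
      rw [map_add, h2]
      linarith
  · rw [map_add]
    exact add_nonneg (hM S) (hC S (mem_filter.1 hS).2)

/-- A single summand other than `f` already contributes 1. Natural coefficients matter here: real
nonnegative ones would give no uniform gap. -/
theorem nsmul_or_one_le {n : ℕ} {f t : Module.Dual ℝ (FSpace n)} (hf : f ∈ Delta n)
    (ht : t ∈ AddSubmonoid.closure (Delta n)) :
    (∃ k : ℕ, t = k • f) ∨ 1 ≤ t (faceSum f) := by
  induction ht using AddSubmonoid.closure_induction with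
  | mem g hg =>
    by_cases h : f = g
    · exact Or.inl ⟨1, by rw [h, one_nsmul]⟩
    · exact Or.inr (one_le_apply_faceSum hg (separated_of_ne hf hg h))
  | zero => exact Or.inl ⟨0, by rw [zero_nsmul]⟩
  | add s t _ _ hs ht =>
    have h0 (k : ℕ) : (k • f) (faceSum f) = 0 := by
      rw [LinearMap.smul_apply, apply_faceSum_self, smul_zero]
    obtain ⟨k, rfl⟩ | hs := hs <;> obtain ⟨l, rfl⟩ | ht := ht
    · exact Or.inl ⟨k + l, by rw [add_nsmul]⟩
    · exact Or.inr (by rwa [LinearMap.add_apply, h0, zero_add])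
    · exact Or.inr (by rwa [LinearMap.add_apply, h0, add_zero])
    · exact Or.inr (by rw [LinearMap.add_apply]; linarith)

/-- Each member of `Delta` is violated by a point that satisfies all other Ingleton
inequalities. -/
theorem exists_violator {n : ℕ} {f : Module.Dual ℝ (FSpace n)} (hf : f ∈ Delta n) :
    ∃ h : FSpace n, f h < 0 ∧ h ∈ solutions (inequalities n \ {f}) := by
  obtain ⟨T, hT⟩ := exists_delta_meet_eq_one hf
  refine ⟨faceSum f - meet T, ?_, ?_⟩
  · rw [map_sub, apply_faceSum_self, hT]
    norm_num
  · rintro t ⟨⟨A, B, C, D, rfl⟩, hne⟩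
    have hle := term_meet_le_one A B C D T
    obtain ⟨k, hk⟩ | h := nsmul_or_one_le hf (term_mem A B C D)
    · have hk1 : k ≤ 1 := by
        rw [hk, LinearMap.smul_apply, hT, nsmul_eq_mul, mul_one] at hle
        exact_mod_cast hle
      interval_cases k
      · rw [hk, zero_nsmul, LinearMap.zero_apply]
      · exact absurd (hk.trans (one_nsmul f)) hne
    · rw [map_sub]
      linarith

/-! ### Characterizing sets are those between `Delta` and all Ingleton inequalities -/

theorem delta_subset_inequalities (n : ℕ) : Delta n ⊆ inequalities n := by
  rintro f ((⟨δ, β, -, -, -, rfl⟩ | ⟨i, j, K, -, -, rfl⟩) | ⟨i, rfl⟩)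
  exacts [⟨_, _, _, _, rfl⟩, ⟨_, _, _, _, rfl⟩, ⟨_, _, _, _, rfl⟩]

theorem solutions_anti {n : ℕ} {S S' : Set (Module.Dual ℝ (FSpace n))} (h : S ⊆ S') :
    solutions S' ⊆ solutions S := fun _ hx f hf => hx f (h hf)

theorem solutions_inequalities (n : ℕ) : solutions (inequalities n) = cone n := by
  ext h
  refine ⟨fun hh A B C D => hh _ ⟨A, B, C, D, rfl⟩, ?_⟩
  rintro hh f ⟨A, B, C, D, rfl⟩
  exact hh A B C D

theorem solutions_delta_subset (n : ℕ) : solutions (Delta n) ⊆ cone n := by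
  intro h hh A B C D
  have ht := term_mem A B C D
  generalize term A B C D = t at ht ⊢
  induction ht using AddSubmonoid.closure_induction with
  | mem g hg => exact hh g hg
  | zero => exact le_rfl
  | add s t _ _ hs ht => exact add_nonneg hs ht

theorem characterizes_iff {n : ℕ} {S : Set (Module.Dual ℝ (FSpace n))} :
    Characterizes S ↔ Delta n ⊆ S ∧ S ⊆ inequalities n := by
  refine ⟨fun ⟨h1, h2⟩ => ⟨fun f hf => ?_, h1⟩, fun ⟨h1, h2⟩ => ⟨h2, ?_⟩⟩
  · by_contra hfS
    obtain ⟨h, hneg, hh⟩ := exists_violator hf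
    -- If `S` omits `f`, the violator of `f` satisfies all of `S` but lies outside the cone.
    have hS : h ∈ solutions S := fun t ht => hh t ⟨h1 ht, fun e => hfS (e ▸ ht)⟩
    rw [h2] at hS
    obtain ⟨A, B, C, D, rfl⟩ := delta_subset_inequalities n hf
    exact absurd (hS A B C D) hneg.not_ge
  · refine ((solutions_anti h1).trans (solutions_delta_subset n)).antisymm ?_
    rw [← solutions_inequalities]
    exact solutions_anti h2

theorem nonredundant_delta (n : ℕ) : Nonredundant (Delta n) := by
  intro f hf himp
  obtain ⟨h, hneg, hh⟩ := exists_violator hf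
  refine absurd (himp h (solutions_anti ?_ hh)) hneg.not_ge
  exact Set.sdiff_subset_sdiff_left (delta_subset_inequalities n)

theorem characterizes_delta (n : ℕ) : Characterizes (Delta n) :=
  characterizes_iff.2 ⟨subset_rfl, delta_subset_inequalities n⟩

end Ingleton

theorem theorem3 (n : ℕ) :
    Ingleton.Nonredundant (Ingleton.Delta n) ∧
      (∀ S : Set (Module.Dual ℝ (Ingleton.FSpace n)),
        Minimal Ingleton.Characterizes S ↔ S = Ingleton.Delta n) ∧
      (∀ S : Set (Module.Dual ℝ (Ingleton.FSpace n)),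
        (Ingleton.Characterizes S ∧ Ingleton.Nonredundant S) ↔ S = Ingleton.Delta n) := by
  refine ⟨Ingleton.nonredundant_delta n, fun S => ⟨fun h => ?_, ?_⟩, fun S => ⟨?_, ?_⟩⟩
  · exact (h.eq_of_superset (Ingleton.characterizes_delta n)
      (Ingleton.characterizes_iff.1 h.prop).1)
  · rintro rfl
    exact ⟨Ingleton.characterizes_delta n, fun S hS _ => (Ingleton.characterizes_iff.1 hS).1⟩
  · rintro ⟨hc, hr⟩
    obtain ⟨h1, h2⟩ := Ingleton.characterizes_iff.1 hc
    refine (h1.antisymm fun f hf => ?_).symm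
    by_contra hfD
    obtain ⟨A, B, C, D, rfl⟩ := h2 hf
    -- A member of `S` outside `Delta` is implied by `Delta`, which is contained in the rest of `S`.
    refine hr _ hf fun h hh => Ingleton.solutions_delta_subset n (fun g hg => ?_) A B C D
    exact hh g ⟨h1 hg, fun e => hfD (e ▸ hg)⟩
  · rintro rfl
    exact ⟨Ingleton.characterizes_delta n, Ingleton.nonredundant_delta n⟩
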